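/- Let $q\ge 2$, let $A\in\mathbb{R}^{n\times n}$, and let $B_{i\sigma}\in\mathbb{R}^{n\times 1}$ ($i=1,\dots,q$, $\sigma=1,\dots,p$) satisfy $\sum_{i=1}^{q}B_{i\sigma}=0$ for every $\sigma$. Consider the array of $q$ systems $$\dot x_i=Ax_i+\sum_{\sigma=1}^{p}B_{i\sigma}u_\sigma,\qquad i=1,\dots,q,$$ with states $x_i(t)\in\mathbb{R}^n$ and scalar (integrable) inputs $u_\sigma$. The array is called controllable if for all initial states $(x_1(0),\dots,x_q(0))$ there are a finite time $\tau>0$ and inputs $u_\sigma:[0,\tau]\to\mathbb{R}$ such that $x_i(\tau)=x_j(\tau)$ for all $i,j$; it is called positively controllable if the inputs can always be chosen with values in $\mathbb{R}_{\ge 0}$. For each real eigenvalue $\mu$ of $A^{*}=A^{T}$ let $V_\mu\in\mathbb{R}^{n\times d_\mu}$ be a matrix of full column rank with $\operatorname{range}V_\mu=\operatorname{null}(A^{*}-\mu I_n)$, and let $\operatorname{inc}(V_\mu^{*}B_{::})\in\mathbb{R}^{(qd_\mu)\times p}$ be the block matrix whose $(i,\sigma)$ block is $V_\mu^{*}B_{i\sigma}$.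 For $d\ge 1$ let $\mathcal{S}_d=\operatorname{range}[\mathbf{1}_q\otimes I_d]\subset\mathbb{R}^{qd}$, where $\mathbf{1}_q$ is the $q$-vector of all ones. A real matrix $G$ with $qd$ rows and $\operatorname{range}G\subset\mathcal{S}_d^{\perp}$ is called strongly connected (with respect to $d$) if $\operatorname{cone}G=\{G\alpha:\alpha\ge 0\}\supset\mathcal{S}_d^{\perp}$, where $\alpha\ge0$ is understood entrywise. Then the array is positively controllable if and only if both of the following hold: 1. the array is controllable; 2. for every real eigenvalue $\mu$ of $A^{*}$, the matrix $\operatorname{inc}(V_\mu^{*}B_{::})$ is strongly connected (with $d=d_\mu$). -/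

import Mathlib

open scoped Matrix

noncomputable section

namespace RelArray

/-! ### Arrays and their controllability

An array of `q` linear time-invariant systems with common state matrix `A` (real, `n` by `n`) and
input vectors `B i σ` in `ℝ ^ n`, driven by `p` scalar inputs `u σ`:
`ẋ i = A (x i) + ∑ σ, u σ • B i σ`. -/

/-- The actuation is relative: `∑ i, B i σ = 0` for each input `σ`. -/
def IsRelative {q p n : ℕ} (B : Fin q → Fin p → (Fin n → ℝ)) : Prop :=
  ∀ σ, ∑ i, B i σ = 0

/-- `x` is a solution of the array equations on `[0, τ]` under the input `u`, in the sense of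
Caratheodory: each `x i` is continuous on `[0, τ]` and satisfies the integrated equation there.
(For `u` integrable on `[0, τ]` this says that `x i` is absolutely continuous and satisfies the
differential equation almost everywhere.) -/
def IsTrajectory {q p n : ℕ} (A : Matrix (Fin n) (Fin n) ℝ) (B : Fin q → Fin p → (Fin n → ℝ))
    (τ : ℝ) (u : Fin p → ℝ → ℝ) (x : Fin q → ℝ → (Fin n → ℝ)) : Prop :=
  ∀ i, ContinuousOn (x i) (Set.Icc 0 τ) ∧
    ∀ t ∈ Set.Icc 0 τ, x i t = x i 0 + ∫ s in (0 : ℝ)..t, (A *ᵥ x i s + ∑ σ, u σ s • B i σ)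

/-- Input signals on `[0, τ]`: integrable functions. -/
def IsInput {p : ℕ} (τ : ℝ) (u : Fin p → ℝ → ℝ) : Prop :=
  ∀ σ, IntervalIntegrable (u σ) MeasureTheory.volume 0 τ

/-- The input `u` steers the initial states `x₀` to synchrony at time `τ`. -/
def Synchronizes {q p n : ℕ} (A : Matrix (Fin n) (Fin n) ℝ) (B : Fin q → Fin p → (Fin n → ℝ))
    (τ : ℝ) (u : Fin p → ℝ → ℝ) (x₀ : Fin q → (Fin n → ℝ)) : Prop :=
  ∃ x : Fin q → ℝ → (Fin n → ℝ), IsTrajectory A B τ u x ∧ (∀ i, x i 0 = x₀ i) ∧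
    ∀ i j, x i τ = x j τ

/-- Controllability of the array. -/
def IsControllable {q p n : ℕ} (A : Matrix (Fin n) (Fin n) ℝ)
    (B : Fin q → Fin p → (Fin n → ℝ)) : Prop :=
  ∀ x₀ : Fin q → (Fin n → ℝ), ∃ τ : ℝ, 0 < τ ∧ ∃ u : Fin p → ℝ → ℝ,
    IsInput τ u ∧ Synchronizes A B τ u x₀

/-- Positive controllability of the array: the inputs can be chosen nonnegative. -/
def IsPositivelyControllable {q p n : ℕ} (A : Matrix (Fin n) (Fin n) ℝ)
    (B : Fin q → Fin p → (Fin n → ℝ)) : Prop :=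
  ∀ x₀ : Fin q → (Fin n → ℝ), ∃ τ : ℝ, 0 < τ ∧ ∃ u : Fin p → ℝ → ℝ,
    IsInput τ u ∧ (∀ σ, ∀ t ∈ Set.Icc 0 τ, 0 ≤ u σ t) ∧ Synchronizes A B τ u x₀

/-! ### Incidence matrices and strong connectivity -/

/-- The incidence matrix of a collection of vectors: the `(i, σ)` block is the column `B i σ`. -/
def inc {q p d : ℕ} (B : Fin q → Fin p → (Fin d → ℝ)) : Matrix (Fin q × Fin d) (Fin p) ℝ :=
  Matrix.of fun r σ => B r.1 σ r.2

/-- The collection `M B`, obtained by multiplying each vector of the collection by `M`. -/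
def mulColl {q p n d : ℕ} (M : Matrix (Fin d) (Fin n) ℝ) (B : Fin q → Fin p → (Fin n → ℝ)) :
    Fin q → Fin p → (Fin d → ℝ) :=
  fun i σ => M *ᵥ B i σ

/-- The synchronization subspace: the range of the Kronecker product of the all-ones column
of length `q` and the `d` by `d` identity. -/
def syncSubspace (q d : ℕ) : Submodule ℝ (EuclideanSpace ℝ (Fin q × Fin d)) :=
  LinearMap.range (Matrix.toEuclideanLin (𝕜 := ℝ)
    (Matrix.kroneckerMap (· * ·) (Matrix.replicateCol (Fin 1) (fun _ : Fin q => (1 : ℝ)))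
      (1 : Matrix (Fin d) (Fin d) ℝ)))

/-- The convex cone of nonnegative combinations of the columns of `G`. -/
def cone {q d p : ℕ} (G : Matrix (Fin q × Fin d) (Fin p) ℝ) :
    Set (EuclideanSpace ℝ (Fin q × Fin d)) :=
  {ζ | ∃ α : Fin p → ℝ, (∀ σ, 0 ≤ α σ) ∧ ζ = WithLp.toLp 2 (G *ᵥ α)}

/-- Generalized incidence matrices: the range is orthogonal to the synchronization subspace. -/
def IsClassG {q d p : ℕ} (G : Matrix (Fin q × Fin d) (Fin p) ℝ) : Prop :=
  ∀ α : Fin p → ℝ, WithLp.toLp 2 (G *ᵥ α) ∈ (syncSubspace q d)ᗮ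

/-- A generalized incidence matrix is strongly connected if its cone contains the orthogonal
complement of the synchronization subspace. -/
def IsStronglyConnected {q d p : ℕ} (G : Matrix (Fin q × Fin d) (Fin p) ℝ) : Prop :=
  IsClassG G ∧ ((syncSubspace q d)ᗮ : Set (EuclideanSpace ℝ (Fin q × Fin d))) ⊆ cone G

/-- `V` has full column rank and its range is the null space of `M - μ I`. -/
def IsEigenbasis {n d : ℕ} (M : Matrix (Fin n) (Fin n) ℝ) (μ : ℝ)
    (V : Matrix (Fin n) (Fin d) ℝ) : Prop :=
  V.rank = d ∧
    LinearMap.range (Matrix.toLin' V) = LinearMap.ker (Matrix.toLin' (M - μ • 1))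

end RelArray

end

/-!
The obstructions to reaching a drift-invariant subspace `S` with nonnegative inputs are the
functionals that vanish on `S` and are nonnegative along all directions `exp (-t L) (b σ)`, `t ≥ 0`.
They form a closed convex cone, invariant under the backward dual flow. Controllability with
unrestricted inputs says that this cone contains no line, and then, unless it is zero, the
Perron–Frobenius theorem gives it an eigenvector of the dual flow, that is, a real eigenvector of
the dual of `L`. For an array these are tuples of eigenvectors of `Aᵀ` summing to zero, and by
duality of cones strong connectivity at `μ` says that no nonzero one pairs nonnegatively with the
input directions.
-/

noncomputable section

open Set Filter Topology MeasureTheory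
open scoped RealInnerProductSpace

section ConvexCones

variable {E : Type*} [NormedAddCommGroup E] [NormedSpace ℝ E]

/-- Order units of the preorder that a convex cone defines on its span. They serve as interior
points of cones which need not span the ambient space. -/
def IsOrderUnit (C : PointedCone ℝ E) (u : E) : Prop :=
  u ∈ C ∧ ∀ z ∈ C, ∃ δ : ℝ, 0 < δ ∧ u - δ • z ∈ C

theorem IsOrderUnit.smul {C : PointedCone ℝ E} {u : E} (hu : IsOrderUnit C u) {c : ℝ}
    (hc : 0 < c) : IsOrderUnit C (c • u) := by
  refine ⟨C.smul_mem hc.le hu.1, fun z hz => ?_⟩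
  obtain ⟨δ, hδ, hmem⟩ := hu.2 z hz
  refine ⟨c * δ, mul_pos hc hδ, ?_⟩
  simpa only [smul_sub, mul_smul] using C.smul_mem hc.le hmem

theorem IsOrderUnit.add_mem {C : PointedCone ℝ E} {u x : E} (hu : IsOrderUnit C u) (hx : x ∈ C) :
    IsOrderUnit C (u + x) := by
  refine ⟨C.add_mem hu.1 hx, fun z hz => ?_⟩
  obtain ⟨δ, hδ, hmem⟩ := hu.2 z hz
  refine ⟨δ, hδ, ?_⟩
  simpa only [sub_add_eq_add_sub] using C.add_mem hmem hx

theorem inv_norm_smul_mem_inter_sphere {K : ProperCone ℝ E} {x : E} (hx : x ∈ K) (hx0 : x ≠ 0) :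
    ‖x‖⁻¹ • x ∈ (K : Set E) ∩ Metric.sphere 0 1 :=
  ⟨K.smul_mem hx (by positivity), by simp [norm_smul, hx0]⟩

/-- The existence of a real eigenvector of `T` in `K`, as a property of `T`. -/
def HasEigenvectorIn (T : E →L[ℝ] E) (K : Set E) : Prop :=
  ∃ x ∈ K, x ≠ 0 ∧ ∃ r : ℝ, T x = r • x

theorem le_opNorm_mul_opNorm_of_sub_smul_mem {K : ProperCone ℝ E} {φ : StrongDual ℝ E}
    (hφ : ∀ x ∈ K, ‖x‖ ≤ φ x) {T : E →L[ℝ] E} {x : E} {r : ℝ} (hx : x ∈ K) (hx0 : x ≠ 0)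
    (hr : 0 ≤ r) (h : T x - r • x ∈ K) : r ≤ ‖φ‖ * ‖T‖ := by
  have hφr : r * φ x ≤ φ (T x) := by simpa using (norm_nonneg _).trans (hφ _ h)
  refine le_of_mul_le_mul_right ?_ (norm_pos_iff.mpr hx0)
  calc
    r * ‖x‖ ≤ r * φ x := mul_le_mul_of_nonneg_left (hφ x hx) hr
    _ ≤ ‖(φ ∘L T) x‖ := hφr.trans (Real.le_norm_self _)
    _ ≤ ‖φ ∘L T‖ * ‖x‖ := (φ ∘L T).le_opNorm x
    _ ≤ ‖φ‖ * ‖T‖ * ‖x‖ := by gcongr; exact φ.opNorm_comp_le T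

variable [FiniteDimensional ℝ E]

/-- Separation makes `C` dense, and a dense convex set in finite dimension is the whole space. -/
theorem pointedCone_eq_top_of_forall_nonneg_imp_eq_zero {C : PointedCone ℝ E}
    (hC : ∀ f : StrongDual ℝ E, (∀ x ∈ C, 0 ≤ f x) → f = 0) : C = ⊤ := by
  have hspan : Submodule.span ℝ (C : Set E) = ⊤ := by
    by_contra h
    obtain ⟨f, hf, hle⟩ := Submodule.exists_le_ker_of_lt_top _ (lt_top_iff_ne_top.mpr h)
    have hfC : ∀ x ∈ C, f x = 0 := fun x hx => hle (Submodule.subset_span hx)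
    exact hf (LinearMap.toContinuousLinearMap.map_eq_zero_iff.mp
      (hC (LinearMap.toContinuousLinearMap f) fun x hx => (hfC x hx).ge))
  have hclosure : closure (C : Set E) = univ := by
    refine eq_univ_of_forall fun z => ?_
    by_contra hz
    obtain ⟨f, hf, hfz⟩ := ProperCone.hyperplane_separation_point (Submodule.closure C) hz
    simp [hC f fun x hx => hf x (subset_closure hx)] at hfz
  have hint : (interior (C : Set E)).Nonempty := by
    rw [C.convex.interior_nonempty_iff_affineSpan_eq_top,
      AffineSubspace.affineSpan_eq_top_iff_vectorSpan_eq_top_of_nonempty ℝ E E ⟨0, C.zero_mem⟩,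
      vectorSpan_eq_span_vsub_set_right ℝ C.zero_mem]
    simpa using hspan
  rw [← SetLike.coe_set_eq, Submodule.top_coe, ← interior_eq_univ,
    ← C.convex.interior_closure_eq_interior_of_nonempty_interior hint, hclosure, interior_univ]

theorem exists_isOrderUnit (C : PointedCone ℝ E) : ∃ u, IsOrderUnit C u := by
  obtain ⟨u, hu⟩ := Set.Nonempty.intrinsicInterior C.convex ⟨0, C.zero_mem⟩
  refine ⟨u, intrinsicInterior_subset hu, fun z hz => ?_⟩
  have hline (δ : ℝ) : u - δ • z ∈ affineSpan ℝ (C : Set E) := by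
    have := AffineSubspace.smul_vsub_vadd_mem (affineSpan ℝ (C : Set E)) (-δ)
      (subset_affineSpan ℝ _ hz) (subset_affineSpan ℝ _ C.zero_mem)
      (subset_affineSpan ℝ _ (intrinsicInterior_subset hu))
    simpa [sub_eq_neg_add] using this
  obtain ⟨v, hv, rfl⟩ := mem_intrinsicInterior.mp hu
  have hlim : Tendsto (fun δ : ℝ => (⟨v - δ • z, hline δ⟩ : affineSpan ℝ (C : Set E)))
      (𝓝[>] 0) (𝓝 v) := by
    refine tendsto_subtype_rng.mpr ((Continuous.tendsto' ?_ 0 _ ?_).mono_left nhdsWithin_le_nhds)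
    · fun_prop
    · simp
  obtain ⟨δ, hδ, hpos⟩ :=
    ((hlim.eventually (mem_interior_iff_mem_nhds.mp hv)).and self_mem_nhdsWithin).exists
  exact ⟨δ, hpos, hδ⟩

theorem exists_strongDual_pos_of_salient {K : ProperCone ℝ E} (hK : (K : ConvexCone ℝ E).Salient) :
    ∃ φ : StrongDual ℝ E, ∀ x ∈ K, x ≠ 0 → 0 < φ x := by
  obtain ⟨φ, hφ, hunit⟩ :=
    exists_isOrderUnit (PointedCone.dual (topDualPairing ℝ E).flip (K : Set E))
  refine ⟨φ, fun x hx hx0 => (hφ hx).lt_of_ne fun hφx => ?_⟩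
  obtain ⟨f, hf, hfx⟩ := K.hyperplane_separation_point (hK x hx hx0)
  obtain ⟨δ, hδ, hle⟩ := hunit f fun y hy => hf y hy
  have hle : 0 ≤ φ x - δ * f x := hle hx
  have hφx : 0 = φ x := hφx
  rw [map_neg, neg_lt_zero] at hfx
  linarith [mul_pos hδ hfx]

theorem exists_strongDual_norm_le_of_salient {K : ProperCone ℝ E}
    (hK : (K : ConvexCone ℝ E).Salient) : ∃ φ : StrongDual ℝ E, ∀ x ∈ K, ‖x‖ ≤ φ x := by
  obtain ⟨φ, hφ⟩ := exists_strongDual_pos_of_salient hK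
  have hS : IsCompact ((K : Set E) ∩ Metric.sphere 0 1) :=
    (isCompact_sphere 0 1).inter_left K.isClosed
  obtain ⟨m, hm, hmle⟩ := hS.exists_forall_le' (f := φ) φ.continuous.continuousOn (a := 0)
    fun x hx => hφ x hx.1 (ne_zero_of_mem_unit_sphere ⟨x, hx.2⟩)
  refine ⟨m⁻¹ • φ, fun x hx => ?_⟩
  obtain rfl | hx0 := eq_or_ne x 0
  · simp
  have hle : m ≤ φ (‖x‖⁻¹ • x) := hmle _ (inv_norm_smul_mem_inter_sphere hx hx0)
  have hpos : 0 < ‖x‖ := norm_pos_iff.mpr hx0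
  rw [map_smul, smul_eq_mul, inv_mul_eq_div, le_div_iff₀ hpos] at hle
  rwa [smul_apply, smul_eq_mul, inv_mul_eq_div, le_div_iff₀' hm]

theorem isClosed_setOf_hasEigenvectorIn (K : ProperCone ℝ E) :
    IsClosed {T : E →L[ℝ] E | HasEigenvectorIn T K} := by
  have hS : IsCompact ((K : Set E) ∩ Metric.sphere 0 1) :=
    (isCompact_sphere 0 1).inter_left K.isClosed
  have := isCompact_iff_compactSpace.mp hS
  -- An eigenvalue of a unit vector `x` is `± ‖T x‖`, so it can be eliminated.
  have hclosed : IsClosed {p : (E →L[ℝ] E) × ↥((K : Set E) ∩ Metric.sphere 0 1) |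
      p.1 p.2 = ‖p.1 p.2‖ • (p.2 : E) ∨ p.1 p.2 = (-‖p.1 p.2‖) • (p.2 : E)} :=
    (isClosed_eq (by fun_prop) (by fun_prop)).union (isClosed_eq (by fun_prop) (by fun_prop))
  convert isClosedMap_fst_of_compactSpace _ hclosed using 1
  ext T
  constructor
  · rintro ⟨x, hx, hx0, r, hr⟩
    have hunit := inv_norm_smul_mem_inter_sphere hx hx0
    have heig : T (‖x‖⁻¹ • x) = r • ‖x‖⁻¹ • x := by rw [map_smul, hr, smul_comm]
    have hnorm : ‖T (‖x‖⁻¹ • x)‖ = |r| := by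
      rw [heig, norm_smul, mem_sphere_zero_iff_norm.mp hunit.2, mul_one, Real.norm_eq_abs]
    refine ⟨(T, ⟨_, hunit⟩), ?_, rfl⟩
    rw [mem_ofPred_eq, hnorm, heig]
    rcases abs_choice r with h | h <;> simp [h]
  · rintro ⟨⟨T, x, hxK, hx1⟩, h | h, rfl⟩
    · exact ⟨x, hxK, ne_zero_of_mem_unit_sphere ⟨x, hx1⟩, _, h⟩
    · exact ⟨x, hxK, ne_zero_of_mem_unit_sphere ⟨x, hx1⟩, _, h⟩

/-- The Collatz–Wielandt argument: the largest `r` with `T x - r x ∈ K` for some unit vector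
`x ∈ K` is an eigenvalue, since otherwise `T x` would admit a larger one. -/
theorem hasEigenvectorIn_of_isOrderUnit {K : ProperCone ℝ E}
    (hK : (K : ConvexCone ℝ E).Salient) (hne : ∃ x ∈ K, x ≠ 0) {T : E →L[ℝ] E}
    (hT : ∀ x ∈ K, x ≠ 0 → IsOrderUnit (K : PointedCone ℝ E) (T x)) : HasEigenvectorIn T K := by
  obtain ⟨φ, hφ⟩ := exists_strongDual_norm_le_of_salient hK
  set P : Set (E × ℝ) := (((K : Set E) ∩ Metric.sphere 0 1) ×ˢ Icc 0 (‖φ‖ * ‖T‖)) ∩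
    {p | T p.1 - p.2 • p.1 ∈ K}
  have hPcompact : IsCompact P :=
    (((isCompact_sphere 0 1).inter_left K.isClosed).prod isCompact_Icc).inter_right
      (K.isClosed.preimage (by fun_prop))
  have hmemP {x : E} {r : ℝ} (hx : x ∈ K) (hx0 : x ≠ 0) (hr : 0 ≤ r) (h : T x - r • x ∈ K) :
      (‖x‖⁻¹ • x, r) ∈ P := by
    refine ⟨⟨inv_norm_smul_mem_inter_sphere hx hx0, hr,
      le_opNorm_mul_opNorm_of_sub_smul_mem hφ hx hx0 hr h⟩, ?_⟩
    have := K.smul_mem h (inv_nonneg.mpr (norm_nonneg x))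
    simpa only [mem_ofPred_eq, map_smul, smul_sub, smul_comm r] using this
  have hTne {x : E} (hx : x ∈ K) (hx0 : x ≠ 0) : T x ≠ 0 := fun h => by
    obtain ⟨δ, hδ, hmem⟩ := (hT x hx hx0).2 x hx
    exact hK (δ • x) (K.smul_mem hx hδ.le) (smul_ne_zero hδ.ne' hx0) (by simpa [h] using hmem)
  obtain ⟨x₀, hx₀, hx₀ne⟩ := hne
  obtain ⟨⟨x, r⟩, ⟨⟨⟨hx, hx1⟩, hr, -⟩, hxr⟩, hmax⟩ := hPcompact.exists_isMaxOn
    ⟨_, hmemP hx₀ hx₀ne le_rfl (by simpa using (hT x₀ hx₀ hx₀ne).1)⟩ continuous_snd.continuousOn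
  have hx0 : x ≠ 0 := ne_zero_of_mem_unit_sphere ⟨x, hx1⟩
  refine ⟨x, hx, hx0, r, sub_eq_zero.mp ?_⟩
  by_contra hy
  obtain ⟨δ, hδ, hmem⟩ := (hT _ hxr hy).2 (T x) (hT x hx hx0).1
  have hTx : T (T x) - (r + δ) • T x ∈ K := by
    rw [add_smul, ← sub_sub, ← map_smul, ← map_sub]
    exact hmem
  have : r + δ ≤ r := hmax (hmemP (hT x hx hx0).1 (hTne hx hx0) (add_nonneg hr hδ.le) hTx)
  linarith

/-- Perron–Frobenius for closed cones: a perturbation maps nonzero points of `K` to order units. -/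
theorem hasEigenvectorIn_of_mapsTo {K : ProperCone ℝ E} (hK : (K : ConvexCone ℝ E).Salient)
    (hne : ∃ x ∈ K, x ≠ 0) {T : E →L[ℝ] E} (hT : ∀ x ∈ K, T x ∈ K) : HasEigenvectorIn T K := by
  obtain ⟨φ, hφ⟩ := exists_strongDual_pos_of_salient hK
  obtain ⟨u, hu⟩ := exists_isOrderUnit (K : PointedCone ℝ E)
  have hperturbed (ε : ℝ) (hε : 0 < ε) : HasEigenvectorIn (T + ε • φ.smulRight u) K := by
    refine hasEigenvectorIn_of_isOrderUnit hK hne fun x hx hx0 => ?_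
    have := (hu.smul (mul_pos hε (hφ x hx hx0))).add_mem (hT x hx)
    simpa [mul_smul, add_comm] using this
  have hlim : Tendsto (fun ε : ℝ => T + ε • φ.smulRight u) (𝓝[>] 0) (𝓝 T) :=
    (Continuous.tendsto' (by fun_prop) 0 T (by simp)).mono_left nhdsWithin_le_nhds
  exact (isClosed_setOf_hasEigenvectorIn K).mem_of_tendsto hlim
    (eventually_mem_nhdsWithin.mono hperturbed)

theorem hasEigenvectorIn_of_hasDerivAt_of_mapsTo {K : ProperCone ℝ E}
    (hK : (K : ConvexCone ℝ E).Salient) (hne : ∃ x ∈ K, x ≠ 0) {T : ℝ → E →L[ℝ] E} {M : E →L[ℝ] E}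
    (hM : HasDerivAt T M 0) (hT0 : T 0 = 1) (hT : ∀ t > 0, ∀ x ∈ K, T t x ∈ K) :
    HasEigenvectorIn M K := by
  have hslope (t : ℝ) (ht : 0 < t) : HasEigenvectorIn (slope T 0 t) K := by
    obtain ⟨x, hx, hx0, r, hr⟩ := hasEigenvectorIn_of_mapsTo hK hne (hT t ht)
    exact ⟨x, hx, hx0, t⁻¹ * (r - 1), by simp [slope_def_module, hT0, hr, mul_smul, sub_smul]⟩
  have hlim : Tendsto (slope T 0) (𝓝[>] 0) (𝓝 M) :=
    (hasDerivAt_iff_tendsto_slope.mp hM).mono_left (nhdsWithin_mono 0 fun t ht => ne_of_gt ht)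
  exact (isClosed_setOf_hasEigenvectorIn K).mem_of_tendsto hlim
    (eventually_mem_nhdsWithin.mono hslope)

theorem forall_mem_pointedCone_iff {H : Type*} [NormedAddCommGroup H] [InnerProductSpace ℝ H]
    [FiniteDimensional ℝ H] {W : Submodule ℝ H} {C : PointedCone ℝ H} (hC : ∀ x ∈ C, x ∈ W) :
    (∀ z ∈ W, z ∈ C) ↔ ∀ z ∈ W, (∀ x ∈ C, 0 ≤ ⟪z, x⟫) → z = 0 := by
  refine ⟨fun h z hz hpos => ?_, fun h z hz => ?_⟩
  · have := hpos (-z) (h (-z) (W.neg_mem hz))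
    rw [inner_neg_right, Left.nonneg_neg_iff] at this
    exact real_inner_self_nonpos.mp this
  · have htop : C ⊔ PointedCone.ofSubmodule Wᗮ = ⊤ := by
      refine pointedCone_eq_top_of_forall_nonneg_imp_eq_zero fun f hf => ?_
      obtain ⟨y, rfl⟩ := (InnerProductSpace.toDual ℝ H).surjective f
      simp only [InnerProductSpace.toDual_apply_apply] at hf
      have hyW : y ∈ W := by
        rw [← Submodule.orthogonal_orthogonal W, Submodule.mem_orthogonal']
        have hpos (v : H) (hv : v ∈ Wᗮ) : 0 ≤ ⟪y, v⟫ :=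
          hf v (Submodule.mem_sup_right hv)
        exact fun v hv => le_antisymm
          (by simpa using hpos (-v) (Submodule.neg_mem _ hv)) (hpos v hv)
      rw [h y hyW fun x hx => hf x (Submodule.mem_sup_left hx), map_zero]
    obtain ⟨c, hc, v, hv, rfl⟩ := Submodule.mem_sup.mp (htop ▸ Submodule.mem_top : z ∈ _)
    have hv0 : v = 0 := (Submodule.disjoint_def.mp W.orthogonal_disjoint) v
      (by simpa using W.sub_mem hz (hC c hc)) hv
    rwa [hv0, add_zero]

end ConvexCones

section Integration

theorem integral_mul_primitive_add_mul {u a a' : ℝ → ℝ} {s t : ℝ}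
    (hu : IntervalIntegrable u volume s t) (ha : ∀ r, HasDerivAt a (a' r) r)
    (ha' : Continuous a') :
    ∫ r in s..t, (a' r * (∫ w in s..r, u w) + a r * u r) = a t * ∫ r in s..t, u r := by
  have hU := hu.absolutelyContinuousOnInterval_intervalIntegral (c := s) left_mem_uIcc
  have hderiv : deriv a = a' := funext fun r => (ha r).deriv
  have haAC : AbsolutelyContinuousOnInterval a s t :=
    (contDiff_one_iff_deriv.mpr ⟨fun r => (ha r).differentiableAt,
      hderiv ▸ ha'⟩).contDiffOn.absolutelyContinuousOnInterval
  have hparts := haAC.integral_deriv_mul_eq_sub hU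
  rw [intervalIntegral.integral_same, mul_zero, sub_zero] at hparts
  rw [← hparts]
  refine intervalIntegral.integral_congr_ae ?_
  filter_upwards [hu.ae_hasDerivAt_integral] with r hr hmem
  rw [hderiv, (hr (uIoc_subset_uIcc hmem) s left_mem_uIcc).deriv]

theorem integral_primitive_smul_add_smul {E : Type*} [NormedAddCommGroup E] [NormedSpace ℝ E]
    [CompleteSpace E] {u : ℝ → ℝ} {a a' : ℝ → E} {s t : ℝ} (hu : IntervalIntegrable u volume s t)
    (ha : ∀ r, HasDerivAt a (a' r) r) (ha' : Continuous a') :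
    ∫ r in s..t, ((∫ w in s..r, u w) • a' r + u r • a r) = (∫ r in s..t, u r) • a t := by
  have haC : Continuous a := continuous_iff_continuousAt.mpr fun r => (ha r).continuousAt
  have hU : ContinuousOn (fun r => ∫ w in s..r, u w) (uIcc s t) :=
    (hu.absolutelyContinuousOnInterval_intervalIntegral left_mem_uIcc).continuousOn
  have hint : IntervalIntegrable (fun r => (∫ w in s..r, u w) • a' r + u r • a r) volume s t :=
    (hU.smul ha'.continuousOn).intervalIntegrable.add (hu.smul_continuousOn haC.continuousOn)
  refine (SeparatingDual.eq_iff_forall_dual_eq (R := ℝ)).mpr fun f => ?_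
  have hf := integral_mul_primitive_add_mul hu (fun r => f.hasFDerivAt.comp_hasDerivAt r (ha r))
    (f.continuous.comp ha')
  simp only [Function.comp_apply] at hf
  rw [← f.intervalIntegral_comp_comm hint, map_smul, smul_eq_mul, mul_comm, ← hf]
  exact intervalIntegral.integral_congr fun r _ => by simp [mul_comm]

theorem nonneg_of_forall_integral_mul_nonneg {g : ℝ → ℝ} (hg : Continuous g) {T : ℝ}
    (h : ∀ v : ℝ → ℝ, Continuous v → (∀ r, 0 ≤ v r) → (∀ r ≥ T, v r = 0) →
      0 ≤ ∫ r in (0 : ℝ)..T, v r * g r) {t : ℝ} (ht : t ∈ Ico 0 T) : 0 ≤ g t := by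
  by_contra! hneg
  set v : ℝ → ℝ := fun r => max 0 (-g r) * max 0 (T - r) with hv
  have hvc : Continuous v := by fun_prop
  have hv0 (r : ℝ) : 0 ≤ v r := mul_nonneg (le_max_left _ _) (le_max_left _ _)
  have hvg (r : ℝ) : 0 ≤ -(v r * g r) := by
    rcases le_total 0 (g r) with h | h
    · simp [hv, max_eq_left (neg_nonpos.mpr h)]
    · exact neg_nonneg.mpr (mul_nonpos_of_nonneg_of_nonpos (hv0 r) h)
  have hvt : 0 < -(v t * g t) := by
    have hT : 0 < T - t := sub_pos.mpr ht.2
    have : v t = -g t * (T - t) := by simp [hv, hneg.le, hT.le]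
    rw [this]
    nlinarith [mul_pos (mul_pos_of_neg_of_neg hneg hneg) hT]
  have hpos : 0 < ∫ r in (0 : ℝ)..T, -(v r * g r) :=
    intervalIntegral.integral_pos (ht.1.trans_lt ht.2) (hvc.mul hg).neg.continuousOn
      (fun r _ => hvg r) ⟨t, Ico_subset_Icc_self ht, hvt⟩
  rw [intervalIntegral.integral_neg] at hpos
  have := h v hvc hv0 fun r hr => by simp [hv, max_eq_left (sub_nonpos.mpr hr)]
  linarith

end Integration

/-- Control systems `ẋ = L x + ∑ σ, u σ • b σ` with drift `L` and input directions `b`, on a state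
space without preferred coordinates. -/
structure LinearSystem (ι E : Type*) [NormedAddCommGroup E] [NormedSpace ℝ E] where
  /-- The generator `L` of the free motion. -/
  drift : E →L[ℝ] E
  /-- The direction `b σ` along which the scalar input `σ` acts. -/
  direction : ι → E

namespace LinearSystem

section Flow

variable {ι E : Type*} [NormedAddCommGroup E] [NormedSpace ℝ E]

/-- The flow `exp (t L)` of the free motion. -/
def flow (P : LinearSystem ι E) (t : ℝ) : E →L[ℝ] E :=
  NormedSpace.exp (t • P.drift)

theorem flow_zero (P : LinearSystem ι E) : P.flow 0 = 1 := by
  rw [flow, zero_smul, NormedSpace.exp_zero]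

variable [CompleteSpace E] (P : LinearSystem ι E)

theorem flow_add (s t : ℝ) : P.flow (s + t) = P.flow s * P.flow t := by
  let _ := NormedAlgebra.restrictScalars ℚ ℝ (E →L[ℝ] E)
  rw [flow, add_smul]
  exact NormedSpace.exp_add_of_commute (((Commute.refl P.drift).smul_left s).smul_right t)

theorem flow_apply_flow_neg (t : ℝ) (x : E) : P.flow t (P.flow (-t) x) = x := by
  rw [← mul_apply_eq_comp, ← flow_add, add_neg_cancel, flow_zero,
    one_apply_eq_self]

theorem hasDerivAt_flow (t : ℝ) : HasDerivAt P.flow (P.flow t * P.drift) t :=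
  hasDerivAt_exp_smul_const P.drift t

theorem hasDerivAt_flow' (t : ℝ) : HasDerivAt P.flow (P.drift * P.flow t) t :=
  hasDerivAt_exp_smul_const' P.drift t

theorem continuous_flow : Continuous P.flow :=
  continuous_iff_continuousAt.mpr fun t => (P.hasDerivAt_flow t).continuousAt

theorem hasDerivAt_flow_neg (t : ℝ) :
    HasDerivAt (fun s => P.flow (-s)) (-(P.flow (-t) * P.drift)) t :=
  (P.hasDerivAt_flow (-t)).scomp t (hasDerivAt_neg t) |>.congr_deriv (by simp)

theorem hasDerivAt_flow_neg_apply (x : E) (t : ℝ) :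
    HasDerivAt (fun s => P.flow (-s) x) (-P.flow (-t) (P.drift x)) t := by
  simpa using (P.hasDerivAt_flow_neg t).clm_apply (hasDerivAt_const t x)

theorem continuous_flow_neg_apply (x : E) : Continuous fun t => P.flow (-t) x :=
  (P.continuous_flow.comp continuous_neg).clm_apply continuous_const

theorem continuous_sum_smul_flow_neg [Fintype ι] {u : ι → ℝ → ℝ} (hu : ∀ σ, Continuous (u σ)) :
    Continuous fun s => ∑ σ, u σ s • P.flow (-s) (P.direction σ) :=
  continuous_finsetSum _ fun σ _ => (hu σ).smul (P.continuous_flow_neg_apply _)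

theorem intervalIntegrable_smul_flow_neg {u : ℝ → ℝ} {t : ℝ}
    (hu : IntervalIntegrable u volume 0 t) (b : E) :
    IntervalIntegrable (fun s => u s • P.flow (-s) b) volume 0 t :=
  hu.smul_continuousOn (P.continuous_flow_neg_apply _).continuousOn

theorem integral_smul_flow_neg {u : ℝ → ℝ} {t : ℝ} (hu : IntervalIntegrable u volume 0 t)
    (b : E) :
    ∫ s in (0 : ℝ)..t, u s • P.flow (-s) b = (∫ s in (0 : ℝ)..t, u s) • P.flow (-t) b +
      ∫ s in (0 : ℝ)..t, (∫ r in (0 : ℝ)..s, u r) • P.flow (-s) (P.drift b) := by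
  have hU : ContinuousOn (fun r => ∫ w in (0 : ℝ)..r, u w) (uIcc 0 t) :=
    (hu.absolutelyContinuousOnInterval_intervalIntegral left_mem_uIcc).continuousOn
  have hint : IntervalIntegrable
      (fun s => (∫ r in (0 : ℝ)..s, u r) • P.flow (-s) (P.drift b)) volume 0 t :=
    (hU.smul (P.continuous_flow_neg_apply _).continuousOn).intervalIntegrable
  rw [← sub_eq_iff_eq_add, ← intervalIntegral.integral_sub
    (P.intervalIntegrable_smul_flow_neg hu b) hint, ← integral_primitive_smul_add_smul hu
    (P.hasDerivAt_flow_neg_apply b) (P.continuous_flow_neg_apply _).neg]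
  simp [sub_eq_neg_add]

end Flow

section InputTerms

variable {ι E : Type*} [NormedAddCommGroup E] [NormedSpace ℝ E] (P : LinearSystem ι E) {τ : ℝ}
  {u : ι → ℝ → ℝ} {x : ℝ → E}

theorem intervalIntegrable_drift (hx : ContinuousOn x (Icc 0 τ)) {t : ℝ} (ht : t ∈ Icc 0 τ) :
    IntervalIntegrable (fun s => P.drift (x s)) volume 0 t :=
  (P.drift.continuous.comp_continuousOn (hx.mono (by
    rw [uIcc_of_le ht.1]
    exact Icc_subset_Icc_right ht.2))).intervalIntegrable

theorem intervalIntegrable_smul_direction (hu : ∀ σ, IntervalIntegrable (u σ) volume 0 τ) {t : ℝ}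
    (ht : t ∈ Icc 0 τ) (σ : ι) :
    IntervalIntegrable (fun s => u σ s • P.direction σ) volume 0 t := by
  refine ((hu σ).mono_set ?_).smul_continuousOn continuousOn_const
  rw [uIcc_of_le ht.1, uIcc_of_le (ht.1.trans ht.2)]
  exact Icc_subset_Icc_right ht.2

theorem intervalIntegrable_sum_smul_direction [Fintype ι]
    (hu : ∀ σ, IntervalIntegrable (u σ) volume 0 τ) {t : ℝ} (ht : t ∈ Icc 0 τ) :
    IntervalIntegrable (fun s => ∑ σ, u σ s • P.direction σ) volume 0 t := by
  simpa only [Finset.sum_fn] using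
    IntervalIntegrable.sum Finset.univ fun σ _ => P.intervalIntegrable_smul_direction hu ht σ

end InputTerms

section Solutions

variable {ι E : Type*} [Fintype ι] [NormedAddCommGroup E] [NormedSpace ℝ E]

/-- Carathéodory solutions on `[0, τ]` for the input `u`. -/
def IsSolution (P : LinearSystem ι E) (τ : ℝ) (u : ι → ℝ → ℝ) (x : ℝ → E) : Prop :=
  ContinuousOn x (Icc 0 τ) ∧
    ∀ t ∈ Icc 0 τ, x t = x 0 + ∫ s in (0 : ℝ)..t, (P.drift (x s) + ∑ σ, u σ s • P.direction σ)

/-- The total effect of the input `u` on `[0, τ]`, transported to time `0` by the free motion. -/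
def steering (P : LinearSystem ι E) (u : ι → ℝ → ℝ) (τ : ℝ) : E :=
  ∫ s in (0 : ℝ)..τ, ∑ σ, u σ s • P.flow (-s) (P.direction σ)

variable {P : LinearSystem ι E} {τ : ℝ} {u : ι → ℝ → ℝ} {x : ℝ → E}

variable [CompleteSpace E]

theorem steering_eq_sum (hu : ∀ σ, IntervalIntegrable (u σ) volume 0 τ) :
    P.steering u τ = ∑ σ, ∫ s in (0 : ℝ)..τ, u σ s • P.flow (-s) (P.direction σ) :=
  intervalIntegral.integral_finsetSum fun σ _ => P.intervalIntegrable_smul_flow_neg (hu σ) _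

theorem IsSolution.sub_primitive_eq (hx : P.IsSolution τ u x)
    (hu : ∀ σ, IntervalIntegrable (u σ) volume 0 τ) {t : ℝ} (ht : t ∈ Icc 0 τ) :
    x t - ∑ σ, (∫ s in (0 : ℝ)..t, u σ s) • P.direction σ =
      x 0 + ∫ s in (0 : ℝ)..t, P.drift (x s) := by
  rw [hx.2 t ht, intervalIntegral.integral_add (P.intervalIntegrable_drift hx.1 ht)
    (P.intervalIntegrable_sum_smul_direction hu ht),
    intervalIntegral.integral_finsetSum fun σ _ => P.intervalIntegrable_smul_direction hu ht σ]
  simp only [intervalIntegral.integral_smul_const]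
  abel

/-- Subtracting the primitives of the inputs from a solution leaves a `C¹` curve, to which the
fundamental theorem of calculus applies even though the inputs are merely integrable. -/
theorem IsSolution.hasDerivAt_sub_primitive (hx : P.IsSolution τ u x)
    (hu : ∀ σ, IntervalIntegrable (u σ) volume 0 τ) {t : ℝ} (ht : t ∈ Ioo 0 τ) :
    HasDerivAt (fun t => x t - ∑ σ, (∫ s in (0 : ℝ)..t, u σ s) • P.direction σ)
      (P.drift (x t)) t := by
  have hnhds : Icc 0 τ ∈ 𝓝 t := Icc_mem_nhds ht.1 ht.2
  have hcont : ContinuousOn (fun s => P.drift (x s)) (Icc 0 τ) :=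
    P.drift.continuous.comp_continuousOn hx.1
  have hmeas : StronglyMeasurableAtFilter (fun s => P.drift (x s)) (𝓝 t) :=
    nhdsWithin_eq_nhds.mpr hnhds ▸ hcont.stronglyMeasurableAtFilter_nhdsWithin measurableSet_Icc t
  exact ((intervalIntegral.integral_hasDerivAt_right
    (P.intervalIntegrable_drift hx.1 (Ioo_subset_Icc_self ht)) hmeas
    (hcont.continuousAt hnhds)).const_add (x 0)).congr_of_eventuallyEq
      (eventually_of_mem hnhds fun s hs => hx.sub_primitive_eq hu hs)

theorem IsSolution.flow_neg_apply_sub_primitive (hx : P.IsSolution τ u x) (hτ : 0 ≤ τ)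
    (hu : ∀ σ, IntervalIntegrable (u σ) volume 0 τ) :
    P.flow (-τ) (x τ - ∑ σ, (∫ s in (0 : ℝ)..τ, u σ s) • P.direction σ) =
      x 0 + ∑ σ, ∫ s in (0 : ℝ)..τ,
        (∫ r in (0 : ℝ)..s, u σ r) • P.flow (-s) (P.drift (P.direction σ)) := by
  set U : ι → ℝ → ℝ := fun σ t => ∫ s in (0 : ℝ)..t, u σ s with hU
  have hUc (σ : ι) : ContinuousOn (U σ) (Icc 0 τ) := uIcc_of_le hτ ▸
    ((hu σ).absolutelyContinuousOnInterval_intervalIntegral left_mem_uIcc).continuousOn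
  have hyc : ContinuousOn (fun t => x t - ∑ σ, U σ t • P.direction σ) (Icc 0 τ) :=
    hx.1.sub (continuousOn_finsetSum _ fun σ _ => (hUc σ).smul continuousOn_const)
  have hUint (σ : ι) : IntervalIntegrable
      (fun s => U σ s • P.flow (-s) (P.drift (P.direction σ))) volume 0 τ :=
    ContinuousOn.intervalIntegrable (uIcc_of_le hτ ▸
      (hUc σ).smul (P.continuous_flow_neg_apply _).continuousOn)
  have hftc := intervalIntegral.integral_eq_sub_of_hasDerivAt_of_le hτ
    ((P.continuous_flow.comp continuous_neg).continuousOn.clm_apply hyc)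
    (fun t ht => ((P.hasDerivAt_flow_neg t).clm_apply
      (hx.hasDerivAt_sub_primitive hu ht)).congr_deriv
      (show _ = ∑ σ, U σ t • P.flow (-t) (P.drift (P.direction σ)) by simp [hU, map_sum]))
    (by simpa only [Finset.sum_fn] using IntervalIntegrable.sum Finset.univ fun σ _ => hUint σ)
  rw [intervalIntegral.integral_finsetSum fun σ _ => hUint σ] at hftc
  rw [hftc]
  simp [hU, P.flow_zero]

theorem IsSolution.flow_neg_apply (hx : P.IsSolution τ u x) (hτ : 0 ≤ τ)
    (hu : ∀ σ, IntervalIntegrable (u σ) volume 0 τ) :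
    P.flow (-τ) (x τ) = x 0 + P.steering u τ := by
  have h := hx.flow_neg_apply_sub_primitive hτ hu
  simp only [map_sub, map_sum, map_smul, sub_eq_iff_eq_add] at h
  rw [h, steering_eq_sum hu]
  simp only [P.integral_smul_flow_neg (hu _), Finset.sum_add_distrib]
  abel

theorem exists_isSolution (P : LinearSystem ι E) (hu : ∀ σ, Continuous (u σ)) (x₀ : E) (τ : ℝ) :
    P.IsSolution τ u fun t => P.flow t (x₀ + P.steering u t) := by
  have hderiv (t : ℝ) : HasDerivAt (fun t => P.flow t (x₀ + P.steering u t))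
      (P.drift (P.flow t (x₀ + P.steering u t)) + ∑ σ, u σ t • P.direction σ) t := by
    have hst : HasDerivAt (P.steering u) (∑ σ, u σ t • P.flow (-t) (P.direction σ)) t :=
      ((P.continuous_sum_smul_flow_neg hu).integral_hasStrictDerivAt 0 t).hasDerivAt
    refine ((P.hasDerivAt_flow' t).clm_apply (hst.const_add x₀)).congr_deriv ?_
    simp [P.flow_apply_flow_neg, map_sum]
  have hcont : Continuous fun t => P.flow t (x₀ + P.steering u t) :=
    continuous_iff_continuousAt.mpr fun t => (hderiv t).continuousAt
  refine ⟨hcont.continuousOn, fun t _ => ?_⟩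
  rw [intervalIntegral.integral_eq_sub_of_hasDerivAt (fun s _ => hderiv s)]
  · abel
  · exact Continuous.intervalIntegrable (by fun_prop) _ _

end Solutions

section Controllability

variable {ι E : Type*} [Fintype ι] [NormedAddCommGroup E] [NormedSpace ℝ E]

/-- Every initial state can be steered into the target `S` in finite time by integrable inputs with
values in `W`. -/
def IsControllableTo (P : LinearSystem ι E) (S : Submodule ℝ E) (W : Set ℝ) : Prop :=
  ∀ x₀, ∃ τ > 0, ∃ u : ι → ℝ → ℝ, (∀ σ, IntervalIntegrable (u σ) volume 0 τ) ∧
    (∀ σ, ∀ t ∈ Icc 0 τ, u σ t ∈ W) ∧ ∃ x, P.IsSolution τ u x ∧ x 0 = x₀ ∧ x τ ∈ S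

theorem IsControllableTo.mono {P : LinearSystem ι E} {S : Submodule ℝ E} {W W' : Set ℝ}
    (h : P.IsControllableTo S W) (hW : W ⊆ W') : P.IsControllableTo S W' := fun x₀ =>
  let ⟨τ, hτ, u, hu, huW, hx⟩ := h x₀
  ⟨τ, hτ, u, hu, fun σ t ht => hW (huW σ t ht), hx⟩

end Controllability

section CostateCone

variable {ι E : Type*} [NormedAddCommGroup E] [NormedSpace ℝ E]

/-- The functionals that vanish on the target `S` and along which no nonnegative input ever pushes
in the negative direction. They are the obstructions to steering into `S` by nonnegative inputs. -/
def costateCone (P : LinearSystem ι E) (S : Submodule ℝ E) : ProperCone ℝ (StrongDual ℝ E) where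
  toSubmodule := PointedCone.dual (topDualPairing ℝ E).flip
    (S ∪ {x | ∃ t ≥ 0, ∃ σ, P.flow (-t) (P.direction σ) = x})
  isClosed' := PointedCone.isClosed_dual fun x =>
    (ContinuousLinearMap.apply ℝ ℝ x).continuous

variable {P : LinearSystem ι E} {S : Submodule ℝ E} {f : StrongDual ℝ E}

theorem forall_mem_submodule_eq_zero_of_nonneg (hf : ∀ x ∈ S, 0 ≤ f x) : ∀ x ∈ S, f x = 0 :=
  fun x hx => le_antisymm (by simpa using hf (-x) (S.neg_mem hx)) (hf x hx)

theorem mem_costateCone : f ∈ P.costateCone S ↔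
    (∀ x ∈ S, f x = 0) ∧ ∀ t ≥ 0, ∀ σ, 0 ≤ f (P.flow (-t) (P.direction σ)) := by
  refine ⟨fun h => ⟨forall_mem_submodule_eq_zero_of_nonneg fun x hx => h (Or.inl hx),
    fun t ht σ => h (Or.inr ⟨t, ht, σ, rfl⟩)⟩, ?_⟩
  rintro ⟨hS, hdir⟩ x (hx | ⟨t, ht, σ, rfl⟩)
  exacts [(hS x hx).ge, hdir t ht σ]

variable [CompleteSpace E]

theorem flow_mapsTo (hSc : IsClosed (S : Set E)) (hS : MapsTo P.drift S S) (t : ℝ) :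
    MapsTo (P.flow t) S S := by
  intro x hx
  have hpow (k : ℕ) : ((t • P.drift) ^ k) x ∈ S := by
    induction k with
    | zero => simpa using hx
    | succ k ih =>
      rw [pow_succ', mul_apply_eq_comp, smul_apply]
      exact S.smul_mem t (hS ih)
  have hsum := (NormedSpace.exp_series_hasSum_exp' (𝕂 := ℝ) (t • P.drift)).mapL
    (ContinuousLinearMap.apply ℝ E x)
  refine hSc.mem_of_tendsto hsum (Eventually.of_forall fun s => S.sum_mem fun k _ => ?_)
  simpa using S.smul_mem _ (hpow k)

theorem comp_flow_neg_mem_costateCone (hSc : IsClosed (S : Set E)) (hS : MapsTo P.drift S S)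
    (hf : f ∈ P.costateCone S) {t : ℝ} (ht : 0 ≤ t) : f ∘L P.flow (-t) ∈ P.costateCone S := by
  rw [mem_costateCone] at hf ⊢
  refine ⟨fun x hx => hf.1 _ (flow_mapsTo hSc hS _ hx), fun s hs σ => ?_⟩
  rw [ContinuousLinearMap.comp_apply, ← mul_apply_eq_comp, ← flow_add, ← neg_add]
  exact hf.2 _ (add_nonneg ht hs) σ

theorem apply_flow_neg_of_eigenfunctional {μ : ℝ} (hf : f ∘L P.drift = μ • f) (t : ℝ) (x : E) :
    f (P.flow (-t) x) = Real.exp (-(μ * t)) * f x := by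
  have hderiv (s : ℝ) : HasDerivAt (fun s => Real.exp (μ * s) * f (P.flow (-s) x)) 0 s := by
    have hfL (y : E) : f (P.drift y) = μ * f y := DFunLike.congr_fun hf y
    have hcomm : P.flow (-s) (P.drift x) = P.drift (P.flow (-s) x) :=
      DFunLike.congr_fun ((P.hasDerivAt_flow (-s)).unique (P.hasDerivAt_flow' (-s))) x
    refine ((((hasDerivAt_id s).const_mul μ).exp).mul
      (f.hasFDerivAt.comp_hasDerivAt s (P.hasDerivAt_flow_neg_apply x s))).congr_deriv ?_
    simp [hcomm, hfL]
    ring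
  have hconst := is_const_of_deriv_eq_zero (fun s => (hderiv s).differentiableAt)
    (fun s => (hderiv s).deriv) t 0
  simp only [mul_zero, Real.exp_zero, neg_zero, flow_zero, one_apply_eq_self, one_mul] at hconst
  rw [← hconst, ← mul_assoc, ← Real.exp_add, neg_add_cancel, Real.exp_zero, one_mul]

theorem mem_costateCone_of_eigenfunctional {μ : ℝ} (hf : f ∘L P.drift = μ • f)
    (hfS : ∀ x ∈ S, f x = 0) (hdir : ∀ σ, 0 ≤ f (P.direction σ)) : f ∈ P.costateCone S := by
  refine mem_costateCone.mpr ⟨hfS, fun t _ σ => ?_⟩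
  rw [apply_flow_neg_of_eigenfunctional hf]
  exact mul_nonneg (Real.exp_pos _).le (hdir σ)

set_option maxSynthPendingDepth 3 in
theorem exists_eigenfunctional_of_salient [FiniteDimensional ℝ E] (hS : MapsTo P.drift S S)
    (hsal : (P.costateCone S : ConvexCone ℝ (StrongDual ℝ E)).Salient)
    (hne : ∃ f ∈ P.costateCone S, f ≠ 0) :
    ∃ f ∈ P.costateCone S, f ≠ 0 ∧ ∃ μ : ℝ, f ∘L P.drift = μ • f := by
  let precomp : (E →L[ℝ] E) →L[ℝ] StrongDual ℝ E →L[ℝ] StrongDual ℝ E :=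
    (ContinuousLinearMap.compL ℝ E E ℝ).flip
  have hderiv : HasDerivAt (fun t => precomp (P.flow (-t))) (precomp (-P.drift)) 0 := by
    have hflow := P.hasDerivAt_flow_neg 0
    rw [neg_zero, flow_zero, one_mul] at hflow
    exact precomp.hasFDerivAt.comp_hasDerivAt 0 hflow
  have hzero : precomp (P.flow (-0)) = 1 := by
    ext f x
    simp [precomp, flow_zero]
  obtain ⟨f, hf, hf0, r, hr⟩ := hasEigenvectorIn_of_hasDerivAt_of_mapsTo hsal hne hderiv hzero
    fun t ht f hf => comp_flow_neg_mem_costateCone S.closed_of_finiteDimensional hS hf ht.le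
  refine ⟨f, hf, hf0, -r, ?_⟩
  ext x
  have hrx : -f (P.drift x) = r * f x := by simpa [precomp] using DFunLike.congr_fun hr x
  simp [← hrx]

end CostateCone

section Necessity

variable {ι E : Type*} [Fintype ι] [NormedAddCommGroup E] [NormedSpace ℝ E] [CompleteSpace E]
  {P : LinearSystem ι E} {S : Submodule ℝ E} {f : StrongDual ℝ E}

theorem IsSolution.apply_initial_eq_neg_integral (hSc : IsClosed (S : Set E))
    (hS : MapsTo P.drift S S) (hf : ∀ x ∈ S, f x = 0) {τ : ℝ} (hτ : 0 ≤ τ) {u : ι → ℝ → ℝ}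
    (hu : ∀ σ, IntervalIntegrable (u σ) volume 0 τ) {x : ℝ → E} (hx : P.IsSolution τ u x)
    (hxτ : x τ ∈ S) :
    f (x 0) = -∫ s in (0 : ℝ)..τ, ∑ σ, u σ s * f (P.flow (-s) (P.direction σ)) := by
  have hint : IntervalIntegrable (fun s => ∑ σ, u σ s • P.flow (-s) (P.direction σ)) volume 0 τ :=
    by simpa only [Finset.sum_fn] using IntervalIntegrable.sum Finset.univ fun σ _ =>
      P.intervalIntegrable_smul_flow_neg (hu σ) (P.direction σ)
  have hfinal := hf _ (flow_mapsTo hSc hS (-τ) hxτ)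
  rw [hx.flow_neg_apply hτ hu, map_add, steering, ← f.intervalIntegral_comp_comm hint] at hfinal
  simpa only [map_sum, map_smul, smul_eq_mul] using eq_neg_of_add_eq_zero_left hfinal

theorem IsControllableTo.eq_zero_of_mem_costateCone (h : P.IsControllableTo S (Ici 0))
    (hSc : IsClosed (S : Set E)) (hS : MapsTo P.drift S S) (hf : f ∈ P.costateCone S) :
    f = 0 := by
  obtain ⟨hfS, hdir⟩ := mem_costateCone.mp hf
  have hnonpos (x₀ : E) : f x₀ ≤ 0 := by
    obtain ⟨τ, hτ, u, hu, hu0, x, hx, rfl, hxτ⟩ := h x₀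
    rw [hx.apply_initial_eq_neg_integral hSc hS hfS hτ.le hu hxτ, neg_nonpos]
    exact intervalIntegral.integral_nonneg hτ.le fun s hs =>
      Finset.sum_nonneg fun σ _ => mul_nonneg (hu0 σ s hs) (hdir s hs.1 σ)
  ext x₀
  exact le_antisymm (hnonpos x₀) (by simpa using hnonpos (-x₀))

theorem IsControllableTo.salient_costateCone {W : Set ℝ} (h : P.IsControllableTo S W)
    (hSc : IsClosed (S : Set E)) (hS : MapsTo P.drift S S) :
    (P.costateCone S : ConvexCone ℝ (StrongDual ℝ E)).Salient := by
  intro f hf hf0 hneg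
  obtain ⟨hfS, hdir⟩ := mem_costateCone.mp hf
  obtain ⟨-, hdir'⟩ := mem_costateCone.mp hneg
  refine hf0 (ContinuousLinearMap.ext fun x₀ => ?_)
  obtain ⟨τ, hτ, u, hu, -, x, hx, rfl, hxτ⟩ := h x₀
  rw [hx.apply_initial_eq_neg_integral hSc hS hfS hτ.le hu hxτ, zero_apply, neg_eq_zero]
  refine intervalIntegral.integral_zero_ae (Eventually.of_forall fun s hs => ?_)
  rw [uIoc_of_le hτ.le] at hs
  refine Finset.sum_eq_zero fun σ _ => mul_eq_zero_of_right _ (le_antisymm ?_ (hdir s hs.1.le σ))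
  simpa using hdir' s hs.1.le σ

end Necessity

section Sufficiency

variable {ι E : Type*} [Fintype ι] [NormedAddCommGroup E] [NormedSpace ℝ E] [CompleteSpace E]

/-- The initial states from which some continuous nonnegative input leads into `S` at all
sufficiently late times. -/
def nullControllableCone (P : LinearSystem ι E) (S : Submodule ℝ E) : PointedCone ℝ E where
  carrier := {x | ∃ u : ι → ℝ → ℝ, (∀ σ, Continuous (u σ)) ∧ (∀ σ t, 0 ≤ u σ t) ∧
    ∀ᶠ τ in atTop, x + P.steering u τ ∈ S}
  zero_mem' := ⟨0, fun _ => continuous_const, fun _ _ => le_rfl, by simp [steering]⟩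
  add_mem' := by
    rintro x y ⟨u, hu, hu0, hx⟩ ⟨v, hv, hv0, hy⟩
    refine ⟨u + v, fun σ => (hu σ).add (hv σ), fun σ t => add_nonneg (hu0 σ t) (hv0 σ t), ?_⟩
    filter_upwards [hx, hy] with τ hxτ hyτ
    have hadd : P.steering (u + v) τ = P.steering u τ + P.steering v τ := by
      simp only [steering, Pi.add_apply, add_smul, Finset.sum_add_distrib]
      exact intervalIntegral.integral_add
        ((P.continuous_sum_smul_flow_neg hu).intervalIntegrable _ _)
        ((P.continuous_sum_smul_flow_neg hv).intervalIntegrable _ _)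
    rw [hadd, add_add_add_comm]
    exact S.add_mem hxτ hyτ
  smul_mem' := by
    rintro ⟨c, hc⟩ x ⟨u, hu, hu0, hx⟩
    refine ⟨c • u, fun σ => (hu σ).const_smul c, fun σ t => mul_nonneg hc (hu0 σ t), ?_⟩
    filter_upwards [hx] with τ hxτ
    have hsmul : P.steering (c • u) τ = c • P.steering u τ := by
      simp only [steering, Pi.smul_apply, smul_assoc, ← Finset.smul_sum,
        intervalIntegral.integral_smul]
    rw [hsmul]
    exact (smul_add c x _) ▸ S.smul_mem c hxτ

variable {P : LinearSystem ι E} {S : Submodule ℝ E} {f : StrongDual ℝ E}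

theorem mem_nullControllableCone_of_mem {x : E} (hx : x ∈ S) : x ∈ P.nullControllableCone S :=
  ⟨0, fun _ => continuous_const, fun _ _ => le_rfl, Eventually.of_forall fun _ => by
    simpa [steering] using hx⟩

theorem neg_integral_mem_nullControllableCone (σ : ι) {v : ℝ → ℝ} (hv : Continuous v)
    (hv0 : ∀ r, 0 ≤ v r) {T : ℝ} (hvT : ∀ r ≥ T, v r = 0) :
    -∫ r in (0 : ℝ)..T, v r • P.flow (-r) (P.direction σ) ∈ P.nullControllableCone S := by
  classical
  refine ⟨Pi.single σ v, fun ρ => ?_, fun ρ r => ?_, ?_⟩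
  · rcases eq_or_ne ρ σ with rfl | h
    · simpa using hv
    · rw [Pi.single_eq_of_ne h]
      exact continuous_const
  · rcases eq_or_ne ρ σ with rfl | h
    · simpa using hv0 r
    · simp [h]
  · filter_upwards [eventually_ge_atTop T] with τ hτ
    have hcont : Continuous fun r => v r • P.flow (-r) (P.direction σ) :=
      hv.smul (P.continuous_flow_neg_apply _)
    have htail : ∫ r in T..τ, v r • P.flow (-r) (P.direction σ) = 0 :=
      intervalIntegral.integral_zero_ae (Eventually.of_forall fun r hr => by
        rw [hvT r (uIoc_of_le hτ ▸ hr).1.le, zero_smul])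
    have hsteer : P.steering (Pi.single σ v) τ =
        ∫ r in (0 : ℝ)..τ, v r • P.flow (-r) (P.direction σ) :=
      intervalIntegral.integral_congr fun r _ => by
        simp [Pi.single_apply, ite_apply, ite_smul]
    rw [hsteer, ← intervalIntegral.integral_add_adjacent_intervals
      (hcont.intervalIntegrable 0 T) (hcont.intervalIntegrable T τ), htail, add_zero,
      neg_add_cancel]
    exact S.zero_mem

theorem neg_mem_costateCone_of_nonneg_on_nullControllableCone
    (hf : ∀ x ∈ P.nullControllableCone S, 0 ≤ f x) : -f ∈ P.costateCone S := by
  refine mem_costateCone.mpr ⟨?_, fun t ht σ => ?_⟩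
  · have hS : ∀ x ∈ S, f x = 0 := forall_mem_submodule_eq_zero_of_nonneg fun x hx =>
      hf x (mem_nullControllableCone_of_mem hx)
    simpa using hS
  · refine nonneg_of_forall_integral_mul_nonneg
      ((-f).continuous.comp (P.continuous_flow_neg_apply (P.direction σ)))
      (fun v hv hv0 hvT => ?_) ⟨ht, lt_add_one t⟩
    have hnonneg := hf _ (neg_integral_mem_nullControllableCone σ hv hv0 hvT)
    rw [map_neg, ← f.intervalIntegral_comp_comm
      (P.intervalIntegrable_smul_flow_neg (hv.intervalIntegrable _ _) _)] at hnonneg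
    simpa using hnonneg

theorem isControllableTo_Ici_of_nullControllableCone_eq_top (hSc : IsClosed (S : Set E))
    (hS : MapsTo P.drift S S) (h : P.nullControllableCone S = ⊤) :
    P.IsControllableTo S (Ici 0) := by
  intro x₀
  obtain ⟨u, hu, hu0, hsteer⟩ : x₀ ∈ P.nullControllableCone S := h ▸ Submodule.mem_top
  obtain ⟨τ, hmem, hτ⟩ := (hsteer.and (eventually_gt_atTop 0)).exists
  refine ⟨τ, hτ, u, fun σ => (hu σ).intervalIntegrable _ _, fun σ t _ => hu0 σ t, _,
    P.exists_isSolution hu x₀ τ, ?_, flow_mapsTo hSc hS τ hmem⟩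
  simp [steering, flow_zero]

end Sufficiency

theorem isControllableTo_Ici_iff {ι E : Type*} [Fintype ι] [NormedAddCommGroup E]
    [NormedSpace ℝ E] [FiniteDimensional ℝ E] {P : LinearSystem ι E} {S : Submodule ℝ E}
    (hS : MapsTo P.drift S S) :
    P.IsControllableTo S (Ici 0) ↔ P.IsControllableTo S univ ∧
      ∀ (μ : ℝ) (f : StrongDual ℝ E), f ∘L P.drift = μ • f → (∀ x ∈ S, f x = 0) →
        (∀ σ, 0 ≤ f (P.direction σ)) → f = 0 := by
  have : CompleteSpace E := FiniteDimensional.complete ℝ E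
  have hSc : IsClosed (S : Set E) := S.closed_of_finiteDimensional
  refine ⟨fun h => ⟨h.mono (subset_univ _), fun μ f hf hfS hdir =>
    h.eq_zero_of_mem_costateCone hSc hS (mem_costateCone_of_eigenfunctional hf hfS hdir)⟩, ?_⟩
  rintro ⟨hcontr, heig⟩
  have hcostate : ∀ f ∈ P.costateCone S, f = 0 := by
    by_contra! hne
    obtain ⟨f, hf, hf0, μ, hμ⟩ :=
      exists_eigenfunctional_of_salient hS (hcontr.salient_costateCone hSc hS) hne
    obtain ⟨hfS, hdir⟩ := mem_costateCone.mp hf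
    exact hf0 (heig μ f hμ hfS fun σ => by simpa [flow_zero] using hdir 0 le_rfl σ)
  exact isControllableTo_Ici_of_nullControllableCone_eq_top hSc hS
    (pointedCone_eq_top_of_forall_nonneg_imp_eq_zero fun f hf => neg_eq_zero.mp
      (hcostate _ (neg_mem_costateCone_of_nonneg_on_nullControllableCone hf)))

end LinearSystem

namespace RelArray

section Array

variable {q p n : ℕ} {A : Matrix (Fin n) (Fin n) ℝ} {B : Fin q → Fin p → (Fin n → ℝ)}

/-- The array as a single linear system on the space of joint states. -/
def toLinearSystem (A : Matrix (Fin n) (Fin n) ℝ) (B : Fin q → Fin p → (Fin n → ℝ)) :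
    LinearSystem (Fin p) (Fin q → Fin n → ℝ) where
  drift := ContinuousLinearMap.pi fun i =>
    (Matrix.mulVecLin A).toContinuousLinearMap ∘L ContinuousLinearMap.proj i
  direction σ i := B i σ

/-- The joint states in which all the systems of the array agree. -/
def synchronizedStates (q n : ℕ) : Submodule ℝ (Fin q → Fin n → ℝ) :=
  LinearMap.range (LinearMap.pi fun _ => LinearMap.id)

theorem toLinearSystem_drift_apply (x : Fin q → Fin n → ℝ) (i : Fin q) :
    (toLinearSystem A B).drift x i = A *ᵥ x i := rfl

theorem toLinearSystem_direction (σ : Fin p) :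
    (toLinearSystem A B).direction σ = fun i => B i σ := rfl

theorem mem_synchronizedStates_iff_forall_eq {x : Fin q → Fin n → ℝ} :
    x ∈ synchronizedStates q n ↔ ∀ i j, x i = x j := by
  refine ⟨?_, fun h => ?_⟩
  · rintro ⟨s, rfl⟩ _ _
    rfl
  · rcases isEmpty_or_nonempty (Fin q) with _ | ⟨⟨j⟩⟩
    · exact ⟨0, Subsingleton.elim _ _⟩
    · exact ⟨x j, funext fun i => h j i⟩

theorem mapsTo_synchronizedStates :
    MapsTo (toLinearSystem A B).drift (synchronizedStates q n) (synchronizedStates q n) := by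
  rintro _ ⟨s, rfl⟩
  exact ⟨A *ᵥ s, rfl⟩

theorem isSolution_toLinearSystem_iff {τ : ℝ} {u : Fin p → ℝ → ℝ} (hu : IsInput τ u)
    {x : ℝ → Fin q → Fin n → ℝ} :
    (toLinearSystem A B).IsSolution τ u x ↔ IsTrajectory A B τ u fun i t => x t i := by
  rw [LinearSystem.IsSolution, IsTrajectory, forall_and, continuousOn_pi]
  refine and_congr_right fun hx => ?_
  have heval (t : ℝ) (ht : t ∈ Icc 0 τ) (i : Fin q) : (∫ s in (0 : ℝ)..t,
      ((toLinearSystem A B).drift (x s) + ∑ σ, u σ s • (toLinearSystem A B).direction σ)) i =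
      ∫ s in (0 : ℝ)..t, (A *ᵥ x s i + ∑ σ, u σ s • B i σ) := by
    have hproj := (ContinuousLinearMap.proj (R := ℝ) (φ := fun _ : Fin q => Fin n → ℝ)
      i).intervalIntegral_comp_comm
        (((toLinearSystem A B).intervalIntegrable_drift (continuousOn_pi.mpr hx) ht).add
          ((toLinearSystem A B).intervalIntegrable_sum_smul_direction hu ht))
    simpa [toLinearSystem_drift_apply, toLinearSystem_direction] using hproj.symm
  rw [forall_comm]
  refine ⟨fun h t i ht => ?_, fun h t ht => funext fun i => ?_⟩
  · rw [← heval t ht i]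
    exact congrFun (h t ht) i
  · rw [Pi.add_apply, heval t ht i]
    exact h t i ht

theorem synchronizes_iff {τ : ℝ} {u : Fin p → ℝ → ℝ} (hu : IsInput τ u)
    {x₀ : Fin q → Fin n → ℝ} :
    Synchronizes A B τ u x₀ ↔ ∃ x, (toLinearSystem A B).IsSolution τ u x ∧ x 0 = x₀ ∧
      x τ ∈ synchronizedStates q n := by
  simp only [isSolution_toLinearSystem_iff hu, mem_synchronizedStates_iff_forall_eq]
  exact ⟨fun ⟨x, hx, h0, hτ⟩ => ⟨fun t i => x i t, hx, funext h0, hτ⟩,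
    fun ⟨x, hx, h0, hτ⟩ => ⟨fun i t => x t i, hx, congrFun h0, hτ⟩⟩

theorem isControllable_iff : IsControllable A B ↔
    (toLinearSystem A B).IsControllableTo (synchronizedStates q n) univ := by
  refine forall_congr' fun x₀ => exists_congr fun τ => and_congr_right fun _ =>
    exists_congr fun u => and_congr_right fun hu => ?_
  simp [synchronizes_iff hu]

theorem isPositivelyControllable_iff : IsPositivelyControllable A B ↔
    (toLinearSystem A B).IsControllableTo (synchronizedStates q n) (Ici 0) :=
  forall_congr' fun _ => exists_congr fun _ => and_congr_right fun _ =>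
    exists_congr fun _ => and_congr_right fun hu => and_congr_right fun _ => synchronizes_iff hu

/-- The pairing of `q` covectors with joint states, `w ↦ (x ↦ ∑ i, w i ⬝ᵥ x i)`, which identifies
the dual of the space of joint states. -/
def blockDual (q n : ℕ) : (Fin q → Fin n → ℝ) ≃ₗ[ℝ] StrongDual ℝ (Fin q → Fin n → ℝ) :=
  (LinearEquiv.piCongrRight fun _ => dotProductEquiv ℝ (Fin n)) ≪≫ₗ
    LinearMap.lsum ℝ (fun _ => Fin n → ℝ) ℝ ≪≫ₗ LinearMap.toContinuousLinearMap

theorem blockDual_apply (w x : Fin q → Fin n → ℝ) : blockDual q n w x = ∑ i, w i ⬝ᵥ x i := by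
  simp [blockDual, LinearMap.lsum_apply]

theorem blockDual_comp_drift_eq_smul_iff {μ : ℝ} {w : Fin q → Fin n → ℝ} :
    blockDual q n w ∘L (toLinearSystem A B).drift = μ • blockDual q n w ↔
      ∀ i, Aᵀ *ᵥ w i = μ • w i := by
  have hcomp : blockDual q n w ∘L (toLinearSystem A B).drift =
      blockDual q n fun i => Aᵀ *ᵥ w i := by
    ext x : 1
    simp only [ContinuousLinearMap.comp_apply, blockDual_apply, toLinearSystem_drift_apply,
      Matrix.dotProduct_mulVec, Matrix.mulVec_transpose]
  rw [hcomp, ← map_smul, (blockDual q n).injective.eq_iff]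
  exact funext_iff

theorem blockDual_eq_zero_on_synchronizedStates_iff {w : Fin q → Fin n → ℝ} :
    (∀ x ∈ synchronizedStates q n, blockDual q n w x = 0) ↔ ∑ i, w i = 0 := by
  have hconst (s : Fin n → ℝ) : blockDual q n w (fun _ => s) = (∑ i, w i) ⬝ᵥ s := by
    rw [blockDual_apply, sum_dotProduct]
  refine ⟨fun h => dotProduct_eq_zero _ fun s => ?_, ?_⟩
  · rw [← hconst]
    exact h _ ⟨s, rfl⟩
  · rintro h _ ⟨s, rfl⟩
    exact (hconst s).trans (by rw [h, zero_dotProduct])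

theorem isPositivelyControllable_iff_eigenvectors : IsPositivelyControllable A B ↔
    IsControllable A B ∧ ∀ (μ : ℝ) (w : Fin q → Fin n → ℝ), ∑ i, w i = 0 →
      (∀ i, Aᵀ *ᵥ w i = μ • w i) → (∀ σ, 0 ≤ ∑ i, w i ⬝ᵥ B i σ) → w = 0 := by
  rw [isPositivelyControllable_iff, isControllable_iff,
    LinearSystem.isControllableTo_Ici_iff mapsTo_synchronizedStates]
  refine and_congr_right fun _ => forall_congr' fun μ => ?_
  rw [(blockDual q n).surjective.forall]
  simp only [blockDual_comp_drift_eq_smul_iff, blockDual_eq_zero_on_synchronizedStates_iff]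
  simp only [toLinearSystem_direction, blockDual_apply, EmbeddingLike.map_eq_zero_iff]
  exact forall_congr' fun _ => forall_comm

end Array

section StrongConnectivity

variable {q p d : ℕ}

theorem toEuclideanLin_kronecker_apply (v : EuclideanSpace ℝ (Fin 1 × Fin d)) (i : Fin q)
    (k : Fin d) :
    Matrix.toEuclideanLin (𝕜 := ℝ)
      (Matrix.kroneckerMap (· * ·) (Matrix.replicateCol (Fin 1) (fun _ : Fin q => (1 : ℝ)))
        (1 : Matrix (Fin d) (Fin d) ℝ)) v (i, k) = v (0, k) := by
  simp [Matrix.toLpLin_apply, Matrix.mulVec, dotProduct, Fintype.sum_prod_type, Matrix.one_apply]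

theorem mem_syncSubspace {z : EuclideanSpace ℝ (Fin q × Fin d)} :
    z ∈ syncSubspace q d ↔ ∃ s : Fin d → ℝ, WithLp.toLp 2 (fun r => s r.2) = z := by
  constructor
  · rintro ⟨v, rfl⟩
    refine ⟨fun k => v (0, k), ?_⟩
    ext ⟨i, k⟩
    exact (toEuclideanLin_kronecker_apply v i k).symm
  · rintro ⟨s, rfl⟩
    refine ⟨WithLp.toLp 2 fun r => s r.2, ?_⟩
    ext ⟨i, k⟩
    exact toEuclideanLin_kronecker_apply _ i k

theorem mem_orthogonal_syncSubspace {z : EuclideanSpace ℝ (Fin q × Fin d)} :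
    z ∈ (syncSubspace q d)ᗮ ↔ ∀ k, ∑ i, z (i, k) = 0 := by
  have hinner (s : Fin d → ℝ) :
      ⟪WithLp.toLp 2 fun r : Fin q × Fin d => s r.2, z⟫ = ∑ k, (∑ i, z (i, k)) * s k := by
    simp only [PiLp.inner_apply, Fintype.sum_prod_type, Finset.sum_mul]
    exact Finset.sum_comm
  rw [Submodule.mem_orthogonal]
  refine ⟨fun h k => ?_, ?_⟩
  · have := h _ (mem_syncSubspace.mpr ⟨Pi.single k 1, rfl⟩)
    rw [hinner] at this
    simpa [Pi.single_apply] using this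
  · rintro h _ hy
    obtain ⟨s, rfl⟩ := mem_syncSubspace.mp hy
    simp [hinner, h]

/-- The cone of `G` as a pointed cone. -/
def columnCone (G : Matrix (Fin q × Fin d) (Fin p) ℝ) :
    PointedCone ℝ (EuclideanSpace ℝ (Fin q × Fin d)) :=
  PointedCone.hull ℝ (range fun σ => WithLp.toLp 2 (G.col σ))

theorem coe_columnCone (G : Matrix (Fin q × Fin d) (Fin p) ℝ) :
    (columnCone G : Set (EuclideanSpace ℝ (Fin q × Fin d))) = cone G := by
  have hmulVec (α : Fin p → ℝ) :
      WithLp.toLp 2 (G *ᵥ α) = ∑ σ, α σ • WithLp.toLp 2 (G.col σ) := by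
    ext r
    simp [Matrix.mulVec, dotProduct, mul_comm]
  ext z
  rw [SetLike.mem_coe, columnCone, PointedCone.hull, Submodule.mem_span_range_iff_exists_fun]
  constructor
  · rintro ⟨c, rfl⟩
    exact ⟨fun σ => c σ, fun σ => (c σ).2, (hmulVec _).symm⟩
  · rintro ⟨α, hα, rfl⟩
    exact ⟨fun σ => ⟨α σ, hα σ⟩, (hmulVec α).symm⟩

theorem IsClassG.isStronglyConnected_iff {G : Matrix (Fin q × Fin d) (Fin p) ℝ}
    (hG : IsClassG G) :
    IsStronglyConnected G ↔ ∀ z ∈ (syncSubspace q d)ᗮ,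
      (∀ σ, 0 ≤ ⟪z, WithLp.toLp 2 (G.col σ)⟫) → z = 0 := by
  have hcone (x) (hx : x ∈ columnCone G) : x ∈ (syncSubspace q d)ᗮ := by
    rw [← SetLike.mem_coe, coe_columnCone] at hx
    obtain ⟨α, -, rfl⟩ := hx
    exact hG α
  have hdual (z : EuclideanSpace ℝ (Fin q × Fin d)) : (∀ x ∈ columnCone G, 0 ≤ ⟪z, x⟫) ↔
      ∀ σ, 0 ≤ ⟪z, WithLp.toLp 2 (G.col σ)⟫ := by
    refine ⟨fun h σ => h _ (Submodule.subset_span ⟨σ, rfl⟩), fun h x hx => ?_⟩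
    induction hx using Submodule.span_induction with
    | mem x hx =>
      obtain ⟨σ, rfl⟩ := hx
      exact h σ
    | zero => simp
    | add x y _ _ hx hy => simpa only [inner_add_right] using add_nonneg hx hy
    | smul c x _ hx =>
      have := mul_nonneg c.2 hx
      simpa [← inner_smul_right] using this
  rw [IsStronglyConnected, and_iff_right hG, ← coe_columnCone]
  simp only [← hdual]
  exact forall_mem_pointedCone_iff hcone

theorem IsRelative.isClassG_inc {M : Fin q → Fin p → (Fin d → ℝ)} (hM : IsRelative M) :
    IsClassG (inc M) := by
  intro α
  refine mem_orthogonal_syncSubspace.mpr fun k => ?_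
  have hcol (σ : Fin p) : ∑ i, M i σ k = 0 := by
    simpa using congrFun (hM σ) k
  simp only [inc, Matrix.mulVec, dotProduct, Matrix.of_apply]
  rw [Finset.sum_comm]
  simp [← Finset.sum_mul, hcol]

theorem isStronglyConnected_inc_iff {M : Fin q → Fin p → (Fin d → ℝ)} (hM : IsRelative M) :
    IsStronglyConnected (inc M) ↔ ∀ ζ : Fin q → Fin d → ℝ, ∑ i, ζ i = 0 →
      (∀ σ, 0 ≤ ∑ i, ζ i ⬝ᵥ M i σ) → ζ = 0 := by
  rw [hM.isClassG_inc.isStronglyConnected_iff]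
  have hinner (z : EuclideanSpace ℝ (Fin q × Fin d)) (σ : Fin p) :
      ⟪z, WithLp.toLp 2 ((inc M).col σ)⟫ = ∑ i, (fun k => z (i, k)) ⬝ᵥ M i σ := by
    simp [PiLp.inner_apply, Fintype.sum_prod_type, dotProduct, inc, mul_comm]
  simp only [mem_orthogonal_syncSubspace, hinner]
  refine ⟨fun h ζ hζ hpos => ?_, fun h z hz hpos => ?_⟩
  · have := h (WithLp.toLp 2 fun r => ζ r.1 r.2) (fun k => by simpa using congrFun hζ k) hpos
    ext i k
    exact congrArg (fun z : EuclideanSpace ℝ (Fin q × Fin d) => z (i, k)) this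
  · have := h (fun i k => z (i, k)) (by ext k; simpa using hz k) hpos
    ext ⟨i, k⟩
    exact congrFun (congrFun this i) k

theorem IsRelative.mulColl {n : ℕ} {B : Fin q → Fin p → (Fin n → ℝ)} (hB : IsRelative B)
    (M : Matrix (Fin d) (Fin n) ℝ) : IsRelative (mulColl M B) := by
  intro σ
  simp only [RelArray.mulColl]
  rw [← Matrix.mulVec_sum, hB σ, Matrix.mulVec_zero]

end StrongConnectivity

section Eigenbasis

variable {q p n d : ℕ} {μ : ℝ} {M : Matrix (Fin n) (Fin n) ℝ} {V : Matrix (Fin n) (Fin d) ℝ}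

theorem IsEigenbasis.mulVec_injective (hV : IsEigenbasis M μ V) : Function.Injective V.mulVec := by
  rw [Matrix.mulVec_injective_iff, linearIndependent_iff_card_eq_finrank_span, Set.finrank,
    ← Matrix.rank_eq_finrank_span_cols, hV.1, Fintype.card_fin]

theorem IsEigenbasis.exists_mulVec_eq_iff (hV : IsEigenbasis M μ V) {v : Fin n → ℝ} :
    (∃ ζ, V *ᵥ ζ = v) ↔ M *ᵥ v = μ • v := by
  have h := SetLike.ext_iff.mp hV.2 v
  rw [LinearMap.mem_range, LinearMap.mem_ker] at h
  simpa only [Matrix.toLin'_apply, Matrix.sub_mulVec, Matrix.smul_mulVec, Matrix.one_mulVec,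
    sub_eq_zero] using h

theorem isStronglyConnected_inc_mulColl_iff {B : Fin q → Fin p → (Fin n → ℝ)} (hB : IsRelative B)
    (hV : IsEigenbasis M μ V) :
    IsStronglyConnected (inc (mulColl Vᵀ B)) ↔ ∀ w : Fin q → Fin n → ℝ, ∑ i, w i = 0 →
      (∀ i, M *ᵥ w i = μ • w i) → (∀ σ, 0 ≤ ∑ i, w i ⬝ᵥ B i σ) → w = 0 := by
  have hpair (ζ : Fin q → Fin d → ℝ) (σ : Fin p) :
      ∑ i, ζ i ⬝ᵥ mulColl Vᵀ B i σ = ∑ i, (V *ᵥ ζ i) ⬝ᵥ B i σ :=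
    Finset.sum_congr rfl fun i _ => by
      rw [mulColl, Matrix.dotProduct_mulVec, Matrix.vecMul_transpose]
  have hsum (ζ : Fin q → Fin d → ℝ) : ∑ i, ζ i = 0 ↔ ∑ i, V *ᵥ ζ i = 0 := by
    rw [← Matrix.mulVec_sum, ← hV.mulVec_injective.eq_iff, Matrix.mulVec_zero]
  have hzero (ζ : Fin q → Fin d → ℝ) : ζ = 0 ↔ (fun i => V *ᵥ ζ i) = 0 := by
    simp only [funext_iff (f := ζ), funext_iff (f := fun i => V *ᵥ ζ i), Pi.zero_apply,
      ← hV.mulVec_injective.eq_iff (b := (0 : Fin d → ℝ)), Matrix.mulVec_zero]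
  rw [isStronglyConnected_inc_iff (hB.mulColl Vᵀ)]
  simp only [hpair, hsum, hzero]
  refine ⟨fun h w hw heig hpos => ?_, fun h ζ hζ hpos =>
    h _ hζ (fun i => hV.exists_mulVec_eq_iff.mp ⟨ζ i, rfl⟩) hpos⟩
  choose ζ hζ using fun i => hV.exists_mulVec_eq_iff.mpr (heig i)
  obtain rfl : (fun i => V *ᵥ ζ i) = w := funext hζ
  exact h ζ hw hpos

end Eigenbasis

end RelArray

end

theorem theorem2 {q p n : ℕ} (hq : 2 ≤ q)
    (A : Matrix (Fin n) (Fin n) ℝ) (B : Fin q → Fin p → (Fin n → ℝ))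
    (hB : RelArray.IsRelative B)
    (d : ℝ → ℕ) (V : (μ : ℝ) → Matrix (Fin n) (Fin (d μ)) ℝ)
    (hV : ∀ μ : ℝ, Module.End.HasEigenvalue (Matrix.toLin' Aᵀ) μ →
      RelArray.IsEigenbasis Aᵀ μ (V μ)) :
    RelArray.IsPositivelyControllable A B ↔
      RelArray.IsControllable A B ∧
        ∀ μ : ℝ, Module.End.HasEigenvalue (Matrix.toLin' Aᵀ) μ →
          RelArray.IsStronglyConnected (RelArray.inc (RelArray.mulColl (V μ)ᵀ B)) := by
  rw [RelArray.isPositivelyControllable_iff_eigenvectors]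
  refine and_congr_right fun _ => forall_congr' fun μ => ?_
  by_cases hμ : Module.End.HasEigenvalue (Matrix.toLin' Aᵀ) μ
  · rw [RelArray.isStronglyConnected_inc_mulColl_iff hB (hV μ hμ)]
    exact ⟨fun h _ => h, fun h => h hμ⟩
  · refine iff_of_true (fun w _ heig _ => funext fun i => ?_) fun h => absurd h hμ
    by_contra hwi
    exact hμ (Module.End.hasEigenvalue_of_hasEigenvector
      (Module.End.hasEigenvector_iff.mpr ⟨Module.End.mem_eigenspace_iff.mpr (heig i), hwi⟩))
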